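/- Let $n$ be a natural number and let $\mathcal H=\mathbb C^2\otimes\mathbb C^n$ be the Hilbert space of a $2\times n$ bipartite quantum system. For an operator $\rho$ on $\mathcal H$ write $\rho^A=\operatorname{Tr}_B\rho$ for its partial trace over the factor $\mathbb C^n$. The concurrence of a density operator $\rho$ on $\mathcal H$ is $$C(\rho)=\inf\Big\{\sum_j p_j\,2\sqrt{\det \pi_j^A}\;:\;\rho=\sum_j p_j\pi_j\Big\},$$ where the infimum is over all finite convex decompositions ($p_j>0$, $\sum_j p_j=1$) of $\rho$ into pure states $\pi_j=|\psi_j\rangle\langle\psi_j|$, with unit vectors $\psi_j\in\mathcal H$. Let $\mathcal H_2$ be a $2$-dimensional subspace of $\mathcal H$. Then for every density operator $\rho$ supported by $\mathcal H_2$ (i.e. with range contained in $\mathcal H_2$) the infimum defining $C(\rho)$ is attained, and there is a unique real number $w=w(\mathcal H_2)$, depending only on $\mathcal H_2$, such that $$C(\rho)^2=4\big(\det\rho^A-w\,\det\rho\big)$$ for all density operators $\rho$ supported by $\mathcal H_2$. Here $\det\rho$ is the determinant of $\rho$ regarded as an operator on the $2$-dimensional space $\mathcal H_2$. -/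

import Mathlib

namespace QubitConcurrence

open scoped ComplexOrder

/-- A density operator of a finite system: positive semidefinite with trace one. -/
def IsDensity {d : Type*} [Fintype d] (ρ : Matrix d d ℂ) : Prop :=
  ρ.PosSemidef ∧ ρ.trace = 1

/-- The rank-one operator `|ψ⟩⟨ψ|`, a pure state when `‖ψ‖ = 1`. -/
def ketBra {d : Type*} (ψ : EuclideanSpace ℂ d) : Matrix d d ℂ :=
  Matrix.of fun i j => ψ i * star (ψ j)

/-- The partial trace over the second tensor factor, `ρ ↦ ρ^A = Tr_B ρ`. -/
def partialTraceB (a b : Type*) [Fintype b] :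
    Matrix (a × b) (a × b) ℂ →ₗ[ℂ] Matrix a a ℂ where
  toFun ρ := Matrix.of fun i j => ∑ k, ρ (i, k) (j, k)
  map_add' ρ σ := by
    ext i j
    simp [Finset.sum_add_distrib]
  map_smul' c ρ := by
    ext i j
    simp [Finset.mul_sum]

/-- The function `G(σ) = 2 √(det σ)` on positive semidefinite `2 × 2` matrices
(whose determinant is real and nonnegative). -/
noncomputable def rootDet (σ : Matrix (Fin 2) (Fin 2) ℂ) : ℝ :=
  2 * Real.sqrt σ.det.re

/-- All values `∑ p_j G(Φ(π_j))`, with `G(σ) = 2 √(det σ)`, over the finite convex decompositions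
`ρ = ∑ p_j π_j` with `p_j > 0`, `∑ p_j = 1` into pure states `π_j = |ψ_j⟩⟨ψ_j|`. -/
def decompositionValues {d : Type*} [Fintype d]
    (Φ : Matrix d d ℂ →ₗ[ℂ] Matrix (Fin 2) (Fin 2) ℂ) (ρ : Matrix d d ℂ) : Set ℝ :=
  {c | ∃ (m : ℕ) (p : Fin m → ℝ) (ψ : Fin m → EuclideanSpace ℂ d),
      (∀ j, 0 < p j) ∧ ∑ j, p j = 1 ∧ (∀ j, ‖ψ j‖ = 1) ∧
      ρ = ∑ j, (p j : ℂ) • ketBra (ψ j) ∧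
      c = ∑ j, p j * rootDet (Φ (ketBra (ψ j)))}

/-- The `Φ`-concurrence: the convex roof of `π ↦ 2 √(det Φ(π))`. -/
noncomputable def phiConcurrence {d : Type*} [Fintype d]
    (Φ : Matrix d d ℂ →ₗ[ℂ] Matrix (Fin 2) (Fin 2) ℂ) (ρ : Matrix d d ℂ) : ℝ :=
  sInf (decompositionValues Φ ρ)

/-- The concurrence of a `2 × n` system is the `Φ`-concurrence for `Φ = Tr_B`. -/
noncomputable def concurrence {n : ℕ} (ρ : Matrix (Fin 2 × Fin n) (Fin 2 × Fin n) ℂ) : ℝ :=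
  phiConcurrence (partialTraceB (Fin 2) (Fin n)) ρ

/-- The operator `ρ` is supported by the subspace `K`: its range lies in `K`
(for Hermitian `ρ`, equivalently, `ρ` vanishes on the orthogonal complement of `K`). -/
def SupportedBy {d : Type*} [Fintype d] [DecidableEq d] (ρ : Matrix d d ℂ)
    (K : Submodule ℂ (EuclideanSpace ℂ d)) : Prop :=
  LinearMap.range (Matrix.toEuclideanLin ρ) ≤ K

/-- The operator `P_K ρ|_K` on the subspace `K`, `P_K` being the orthogonal projection. -/
noncomputable def operatorOn {d : Type*} [Fintype d] [DecidableEq d]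
    (K : Submodule ℂ (EuclideanSpace ℂ d)) (ρ : Matrix d d ℂ) : K →ₗ[ℂ] K :=
  K.orthogonalProjectionOnto.toLinearMap ∘ₗ Matrix.toEuclideanLin ρ ∘ₗ K.subtype

/-- For `ρ` supported by `K`, `operatorOn K ρ` is the restriction of `ρ` to `K`. -/
theorem operatorOn_apply_of_supportedBy {d : Type*} [Fintype d] [DecidableEq d]
    (K : Submodule ℂ (EuclideanSpace ℂ d)) (ρ : Matrix d d ℂ) (h : SupportedBy ρ K) (x : K) :
    (operatorOn K ρ x : EuclideanSpace ℂ d) = Matrix.toEuclideanLin ρ x := by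
  have hx : Matrix.toEuclideanLin ρ (x : EuclideanSpace ℂ d) ∈ K := h ⟨_, rfl⟩
  exact Submodule.starProjection_eq_self_iff.mpr hx

/-- The determinant of `ρ` as an operator on the subspace `K` that supports it. -/
noncomputable def detOn {d : Type*} [Fintype d] [DecidableEq d]
    (K : Submodule ℂ (EuclideanSpace ℂ d)) (ρ : Matrix d d ℂ) : ℂ :=
  LinearMap.det (operatorOn K ρ)

end QubitConcurrence

/-!
A state supported by the two-dimensional subspace is a Hermitian `2 × 2` matrix `x` in an
orthonormal basis of that subspace, hence a point of the forward light cone of the real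
four-dimensional space on which `det x` is the Minkowski form. Pure states are the null vectors
of the cone. The determinant of the partial trace becomes a real quadratic form `q`, nonnegative on
the null cone since the partial trace is positive.

In this situation there is a real `w` for which `F = q - w det` is positive semidefinite. For the
smallest such `w` there is moreover a nonzero vector `k` with `F k = 0` and `det k ≤ 0`
(`QuadraticForm.exists_nonneg_sub_smul_and_isotropic`). Then `√F` is a seminorm which agrees with
`√q` on pure states, so every convex decomposition of a state `x` has value at least `2 √(F x)`.
Conversely `F` is constant on lines in the direction `k`. As `k` is not timelike, such a line
through a mixed state `x` meets the null cone, and this writes `x` as a sum of two unnormalized pure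
states on which `√F` is additive (`QubitConcurrence.exists_null_add_null`). So the infimum is
attained and equals `2 √(F x)`, that is, the square of the concurrence is `4 (q - w det)`. The
vectors of a convex decomposition lie in the subspace automatically
(`QubitConcurrence.toEuclideanLin_eq_self_of_sum_eq`).

The argument works for any positive map into the `2 × 2` matrices in place of the partial trace. The
value of `w` is determined by the normalized projection onto the subspace, whose determinant is not
zero.
-/

namespace QuadraticForm

/-! ### Degenerate positive semidefinite members of a real quadratic pencil -/

section

variable {V : Type*} [AddCommGroup V] [Module ℝ V]

theorem map_add_smul_real (q : QuadraticForm ℝ V) (a b : V) (t : ℝ) :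
    q (a + t • b) = q a + t * QuadraticMap.polar q a b + t ^ 2 * q b := by
  rw [QuadraticMap.map_add q, QuadraticMap.map_smul, QuadraticMap.polar_smul_right]
  simp only [smul_eq_mul]
  ring

theorem exists_neg_pos_roots {α β γ : ℝ} (hα : α < 0) (hγ : 0 < γ) :
    ∃ s t : ℝ, s < 0 ∧ 0 < t ∧ α + s * β + s ^ 2 * γ = 0 ∧ α + t * β + t ^ 2 * γ = 0 ∧
      s * t * γ = α := by
  set r := √(β ^ 2 - 4 * α * γ) with hr
  have hαγ : α * γ < 0 := mul_neg_of_neg_of_pos hα hγ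
  have hr2 : r ^ 2 = β ^ 2 - 4 * α * γ := Real.sq_sqrt (by nlinarith [sq_nonneg β])
  have hβr : |β| < r := by
    rw [hr]
    apply Real.lt_sqrt_of_sq_lt
    rw [sq_abs]
    linarith
  obtain ⟨h1, h2⟩ := abs_lt.1 hβr
  refine ⟨(-β - r) / (2 * γ), (-β + r) / (2 * γ), div_neg_of_neg_of_pos (by linarith) (by linarith),
    div_pos (by linarith) (by linarith), ?_, ?_, ?_⟩ <;> field_simp <;> linarith

/-- If `q` is nonnegative on the null cone of `d`, the quotient `q / d` is at most as large on
`{d < 0}` as it is on `{0 < d}`. Along the line `a + t • b` the form `q - (q b / d b) • d` is affine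
in `t`, and it is nonnegative at the two zeros of `d`, which lie on both sides of `t = 0`. -/
theorem mul_le_mul_of_nonneg_on_null {q d : QuadraticForm ℝ V} (h : ∀ x, d x = 0 → 0 ≤ q x)
    {a b : V} (ha : d a < 0) (hb : 0 < d b) : q b * d a ≤ q a * d b := by
  obtain ⟨s, t, hs, ht, hs0, ht0, hst⟩ :=
    exists_neg_pos_roots (β := QuadraticMap.polar d a b) ha hb
  have h1 := h (a + s • b) (by rw [map_add_smul_real, hs0])
  have h2 := h (a + t • b) (by rw [map_add_smul_real, ht0])
  rw [map_add_smul_real] at h1 h2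
  have h3 : 0 ≤ (t - s) * (q a - s * t * q b) := by
    nlinarith [mul_nonneg ht.le h1, mul_nonneg (neg_nonneg.2 hs.le) h2]
  have h4 : 0 ≤ q a - s * t * q b := nonneg_of_mul_nonneg_right h3 (by linarith)
  have h5 := mul_nonneg h4 hb.le
  have h6 : q b * d a = s * t * q b * d b := by rw [← hst]; ring
  linarith

/-- The Cauchy–Schwarz inequality. -/
theorem polar_sq_le {F : QuadraticForm ℝ V} (hF : ∀ x, 0 ≤ F x) (x y : V) :
    QuadraticMap.polar F x y ^ 2 ≤ 4 * F y * F x := by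
  have h : ∀ t : ℝ, 0 ≤ F y * (t * t) + QuadraticMap.polar F x y * t + F x := fun t ↦ by
    have := hF (x + t • y)
    rw [map_add_smul_real] at this
    linarith
  have := discrim_le_zero h
  rw [discrim] at this
  linarith

theorem map_add_smul_eq_of_map_eq_zero {F : QuadraticForm ℝ V} (hF : ∀ x, 0 ≤ F x) {k : V}
    (hk : F k = 0) (x : V) (t : ℝ) : F (x + t • k) = F x := by
  have h := polar_sq_le hF x k
  have h0 : QuadraticMap.polar F x k = 0 := by
    rw [hk] at h
    exact pow_eq_zero_iff two_ne_zero |>.1 (le_antisymm (by linarith) (sq_nonneg _))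
  rw [map_add_smul_real, hk, h0]
  ring

theorem sqrt_map_smul (F : QuadraticForm ℝ V) {t : ℝ} (ht : 0 ≤ t) (x : V) :
    √(F (t • x)) = t * √(F x) := by
  rw [QuadraticMap.map_smul, smul_eq_mul, Real.sqrt_mul (mul_nonneg ht ht), Real.sqrt_mul_self ht]

theorem sqrt_map_add_le {F : QuadraticForm ℝ V} (hF : ∀ x, 0 ≤ F x) (x y : V) :
    √(F (x + y)) ≤ √(F x) + √(F y) := by
  rw [Real.sqrt_le_left (by positivity), QuadraticMap.map_add F, add_sq, Real.sq_sqrt (hF x),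
    Real.sq_sqrt (hF y)]
  have h : QuadraticMap.polar F x y ≤ 2 * √(F x) * √(F y) := by
    apply le_of_sq_le_sq _ (by positivity)
    rw [mul_pow, mul_pow, Real.sq_sqrt (hF x), Real.sq_sqrt (hF y)]
    linarith [polar_sq_le hF x y]
  linarith

theorem sqrt_map_sum_le {F : QuadraticForm ℝ V} (hF : ∀ x, 0 ≤ F x) {ι : Type*} (s : Finset ι)
    (x : ι → V) : √(F (∑ i ∈ s, x i)) ≤ ∑ i ∈ s, √(F (x i)) :=
  Finset.le_sum_of_subadditive (fun x ↦ √(F x)) (by simp) (sqrt_map_add_le hF) s x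

/-- A real quadratic pencil `q - w • d`, with `d` indefinite and `q` nonnegative on the null cone
of `d`, has a positive semidefinite member. The smallest such `w`, namely the supremum of `q / d` on
`{d < 0}`, makes it degenerate: a limit `k` of normalized maximizing vectors is an isotropic vector
of `q - w • d`, and `d k ≤ 0` as `d` is negative along the sequence. -/
theorem exists_nonneg_sub_smul_and_isotropic {V : Type*} [NormedAddCommGroup V] [NormedSpace ℝ V]
    [ProperSpace V] {q d : QuadraticForm ℝ V} (hq : Continuous q) (hd : Continuous d)
    (h : ∀ x, d x = 0 → 0 ≤ q x) (hneg : ∃ a, d a < 0) (hpos : ∃ b, 0 < d b) :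
    ∃ w : ℝ, (∀ x, 0 ≤ (q - w • d) x) ∧ ∃ k ≠ 0, (q - w • d) k = 0 ∧ d k ≤ 0 := by
  obtain ⟨a, ha⟩ := hneg
  obtain ⟨b, hb⟩ := hpos
  set S : Set ℝ := (fun x ↦ q x / d x) '' {x | d x < 0} with hS
  have hle : ∀ b, 0 < d b → ∀ r ∈ S, r ≤ q b / d b := by
    rintro b hb _ ⟨a, ha, rfl⟩
    have := mul_le_mul_of_nonneg_on_null h ha hb
    rw [div_le_iff_of_neg ha, div_mul_eq_mul_div, div_le_iff₀ hb]
    exact this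
  have hne : S.Nonempty := ⟨_, a, ha, rfl⟩
  have hbdd : BddAbove S := ⟨_, hle b hb⟩
  refine ⟨sSup S, fun x ↦ ?_, ?_⟩
  · simp only [sub_apply, smul_apply, smul_eq_mul, sub_nonneg]
    rcases lt_trichotomy (d x) 0 with hx | hx | hx
    · exact (div_le_iff_of_neg hx).1 (le_csSup hbdd ⟨x, hx, rfl⟩)
    · rw [hx, mul_zero]
      exact h x hx
    · exact (le_div_iff₀ hx).1 (csSup_le hne (hle x hx))
  · obtain ⟨u, -, hu, huS⟩ := exists_seq_tendsto_sSup hne hbdd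
    choose v hv hvu using huS
    have hv0 : ∀ n, v n ≠ 0 := fun n h0 ↦ by
      have := hv n
      simp [h0] at this
    have hv1 : ∀ n, ‖v n‖ ≠ 0 := fun n ↦ norm_ne_zero_iff.2 (hv0 n)
    obtain ⟨k, hk, φ, hφ, hlim⟩ := (isCompact_sphere (0 : V) 1).tendsto_subseq
      (x := fun n ↦ ‖v n‖⁻¹ • v n) (fun n ↦ by simp [norm_smul, hv1 n])
    have hdlim := (hd.tendsto k).comp hlim
    have hqlim := (hq.tendsto k).comp hlim
    refine ⟨k, fun h0 ↦ by simp [h0] at hk, ?_, ?_⟩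
    · -- Each `v n` satisfies `q (v n) = u n * d (v n)`, an equation that passes to the limit.
      have h1 := hqlim.sub ((hu.comp hφ.tendsto_atTop).mul hdlim)
      have h2 : q k - sSup S * d k = 0 := by
        refine tendsto_nhds_unique h1 (tendsto_const_nhds.congr fun n ↦ ?_)
        have h3 : d (v (φ n)) ≠ 0 := (hv _).ne
        simp only [Function.comp_apply, QuadraticMap.map_smul, smul_eq_mul, ← hvu]
        field_simp
        ring
      simpa using h2
    · refine le_of_tendsto' hdlim fun n ↦ ?_
      simp only [Function.comp_apply, QuadraticMap.map_smul, smul_eq_mul]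
      exact mul_nonpos_of_nonneg_of_nonpos (mul_self_nonneg _) (hv _).le

end

end QuadraticForm

namespace QubitConcurrence

open scoped ComplexOrder

/-! ### Hermitian matrices of size two as Minkowski space -/

/-- The real part of the determinant, as a real quadratic form on the complex `2 × 2` matrices. -/
noncomputable def reDet : QuadraticForm ℝ (Matrix (Fin 2) (Fin 2) ℂ) :=
  QuadraticMap.ofPolar (fun M ↦ M.det.re)
    (fun a M ↦ by simp [Matrix.det_fin_two, sq])
    (fun M M' N ↦ by simp [QuadraticMap.polar, Matrix.det_fin_two]; ring)
    (fun a M N ↦ by simp [QuadraticMap.polar, Matrix.det_fin_two, sq]; ring)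

theorem reDet_apply (M : Matrix (Fin 2) (Fin 2) ℂ) : reDet M = M.det.re := rfl

/-- The Hermitian `2 × 2` matrix with diagonal `x 0, x 1` and upper right entry `x 2 + i x 3`. -/
noncomputable def herm : (Fin 4 → ℝ) →ₗ[ℝ] Matrix (Fin 2) (Fin 2) ℂ where
  toFun x := !![(x 0 : ℂ), ⟨x 2, x 3⟩; ⟨x 2, -x 3⟩, (x 1 : ℂ)]
  map_add' x y := by
    ext i j
    fin_cases i <;> fin_cases j <;> simp [Complex.ext_iff]
    ring
  map_smul' c x := by
    ext i j
    fin_cases i <;> fin_cases j <;> simp [Complex.ext_iff]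

theorem herm_apply (x : Fin 4 → ℝ) :
    herm x = !![(x 0 : ℂ), ⟨x 2, x 3⟩; ⟨x 2, -x 3⟩, (x 1 : ℂ)] := rfl

/-- The real coordinates of a `2 × 2` matrix, a left inverse of `herm` which is also a right inverse
on the Hermitian matrices. -/
def hermCoord : Matrix (Fin 2) (Fin 2) ℂ →ₗ[ℝ] (Fin 4 → ℝ) where
  toFun M := ![(M 0 0).re, (M 1 1).re, (M 0 1).re, (M 0 1).im]
  map_add' M N := by
    ext i
    fin_cases i <;> simp
  map_smul' c M := by
    ext i
    fin_cases i <;> simp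

theorem hermCoord_apply (M : Matrix (Fin 2) (Fin 2) ℂ) :
    hermCoord M = ![(M 0 0).re, (M 1 1).re, (M 0 1).re, (M 0 1).im] := rfl

theorem herm_hermCoord {M : Matrix (Fin 2) (Fin 2) ℂ} (hM : M.IsHermitian) :
    herm (hermCoord M) = M := by
  have h : ∀ i j, star (M j i) = M i j := fun i j ↦ hM.apply i j
  have h0 := h 0 0
  have h1 := h 1 1
  have h2 := h 1 0
  simp only [Complex.star_def, Complex.ext_iff, Complex.conj_re, Complex.conj_im] at h0 h1 h2
  ext i j
  fin_cases i <;> fin_cases j <;> simp [herm_apply, hermCoord_apply, Complex.ext_iff] <;>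
    first | linarith | exact ⟨h2.1, h2.2⟩

/-- The determinant of `herm x`, a quadratic form of signature `(1, 3)`. -/
noncomputable def minkowski : QuadraticForm ℝ (Fin 4 → ℝ) := reDet.comp herm

theorem minkowski_apply (x : Fin 4 → ℝ) : minkowski x = x 0 * x 1 - (x 2 ^ 2 + x 3 ^ 2) := by
  simp [minkowski, reDet_apply, herm_apply, Matrix.det_fin_two]
  ring

theorem det_herm (x : Fin 4 → ℝ) : (herm x).det = (minkowski x : ℂ) := by
  simp [minkowski_apply, herm_apply, Matrix.det_fin_two, Complex.ext_iff, sq]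
  ring

theorem polar_minkowski (x y : Fin 4 → ℝ) :
    QuadraticMap.polar minkowski x y =
      x 0 * y 1 + x 1 * y 0 - 2 * (x 2 * y 2 + x 3 * y 3) := by
  simp only [QuadraticMap.polar, minkowski_apply, Pi.add_apply]
  ring

/-- The forward light cone, whose points are the coordinates of the positive semidefinite
matrices. -/
def forwardCone : Set (Fin 4 → ℝ) := {x | 0 ≤ x 0 ∧ 0 ≤ x 1 ∧ 0 ≤ minkowski x}

theorem mem_or_neg_mem_forwardCone {x : Fin 4 → ℝ} (hx : 0 ≤ minkowski x) :
    x ∈ forwardCone ∨ -x ∈ forwardCone := by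
  have h : 0 ≤ x 0 * x 1 := by
    rw [minkowski_apply] at hx
    nlinarith [sq_nonneg (x 2), sq_nonneg (x 3)]
  rcases mul_nonneg_iff.1 h with h | h
  · exact .inl ⟨h.1, h.2, hx⟩
  · refine .inr ⟨?_, ?_, by rwa [QuadraticMap.map_neg]⟩ <;> simp [h]

theorem sq_spatial_inner_le (x y : Fin 4 → ℝ) :
    (x 2 * y 2 + x 3 * y 3) ^ 2 ≤ (x 0 * x 1 - minkowski x) * (y 0 * y 1 - minkowski y) := by
  simp only [minkowski_apply]
  nlinarith [sq_nonneg (x 2 * y 3 - x 3 * y 2)]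

/-- The reversed Cauchy–Schwarz inequality. -/
theorem polar_minkowski_nonneg {x y : Fin 4 → ℝ} (hx : x ∈ forwardCone) (hy : y ∈ forwardCone) :
    0 ≤ QuadraticMap.polar minkowski x y := by
  obtain ⟨hx0, hx1, hx⟩ := hx
  obtain ⟨hy0, hy1, hy⟩ := hy
  have h := sq_spatial_inner_le x y
  have h1 : (x 0 * x 1 - minkowski x) * (y 0 * y 1 - minkowski y) ≤ (x 0 * x 1) * (y 0 * y 1) := by
    have : 0 ≤ y 0 * y 1 - minkowski y := by
      rw [minkowski_apply]
      nlinarith [sq_nonneg (y 2), sq_nonneg (y 3)]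
    exact mul_le_mul (by linarith) (by linarith) this (mul_nonneg hx0 hx1)
  have h2 : (2 * (x 2 * y 2 + x 3 * y 3)) ^ 2 ≤ (x 0 * y 1 + x 1 * y 0) ^ 2 := by
    nlinarith [sq_nonneg (x 0 * y 1 - x 1 * y 0)]
  have h3 := le_of_sq_le_sq h2 (by positivity)
  rw [polar_minkowski]
  linarith

theorem polar_minkowski_pos {x y : Fin 4 → ℝ} (hx : x ∈ forwardCone) (hx' : 0 < minkowski x)
    (hy : y ∈ forwardCone) (hy' : y ≠ 0) : 0 < QuadraticMap.polar minkowski x y := by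
  refine (polar_minkowski_nonneg hx hy).lt_of_ne' fun h0 ↦ hy' ?_
  rw [polar_minkowski] at h0
  obtain ⟨hx0, hx1, hx⟩ := hx
  obtain ⟨hy0, hy1, hy⟩ := hy
  have hxx : 0 < x 0 * x 1 := by
    rw [minkowski_apply] at hx'
    nlinarith [sq_nonneg (x 2), sq_nonneg (x 3)]
  have hx0' : 0 < x 0 := lt_of_le_of_ne hx0 fun h ↦ by simp [← h] at hxx
  have hx1' : 0 < x 1 := lt_of_le_of_ne hx1 fun h ↦ by simp [← h] at hxx
  have h := sq_spatial_inner_le x y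
  have hyy : 0 ≤ y 0 * y 1 - minkowski y := by
    rw [minkowski_apply]
    nlinarith [sq_nonneg (y 2), sq_nonneg (y 3)]
  have h1 : (x 0 * x 1 - minkowski x) * (y 0 * y 1 - minkowski y) ≤
      (x 0 * x 1 - minkowski x) * (y 0 * y 1) := by
    apply mul_le_mul_of_nonneg_left (by linarith)
    rw [minkowski_apply]
    nlinarith [sq_nonneg (x 2), sq_nonneg (x 3)]
  have h2 : x 2 * y 2 + x 3 * y 3 = (x 0 * y 1 + x 1 * y 0) / 2 := by linarith
  have h3 : minkowski x * (y 0 * y 1) ≤ 0 := by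
    rw [h2] at h
    nlinarith [sq_nonneg (x 0 * y 1 - x 1 * y 0)]
  have h4 : y 0 * y 1 = 0 := le_antisymm (nonpos_of_mul_nonpos_right h3 hx') (mul_nonneg hy0 hy1)
  rw [minkowski_apply, h4] at hy
  have h5 : y 2 = 0 := by nlinarith [sq_nonneg (y 2), sq_nonneg (y 3)]
  have h6 : y 3 = 0 := by nlinarith [sq_nonneg (y 2), sq_nonneg (y 3)]
  rw [h5, h6] at h0
  have h7 := mul_nonneg hx0 hy1
  have h8 := mul_nonneg hx1 hy0
  have h9 : y 1 = 0 := by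
    have : x 0 * y 1 = 0 := by linarith
    exact (mul_eq_zero.1 this).resolve_left hx0'.ne'
  have h10 : y 0 = 0 := by
    have : x 1 * y 0 = 0 := by linarith
    exact (mul_eq_zero.1 this).resolve_left hx1'.ne'
  ext i
  fin_cases i <;> assumption

/-- Two null vectors with a sum inside the forward cone both lie in the forward cone. The polar form
is positive at the two vectors, so they are both forward or both backward, and the latter
contradicts `polar_minkowski_nonneg` for `u + v` and `-u`. -/
theorem mem_forwardCone_of_add {u v : Fin 4 → ℝ} (hu : minkowski u = 0) (hv : minkowski v = 0)
    (h : u + v ∈ forwardCone) (h' : 0 < minkowski (u + v)) : u ∈ forwardCone ∧ v ∈ forwardCone := by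
  have hp : 0 < QuadraticMap.polar minkowski u v := by
    rw [QuadraticMap.map_add minkowski, hu, hv] at h'
    linarith
  have hu' := mem_or_neg_mem_forwardCone hu.ge
  have hv' := mem_or_neg_mem_forwardCone hv.ge
  rcases hu' with hu' | hu' <;> rcases hv' with hv' | hv'
  · exact ⟨hu', hv'⟩
  · have := polar_minkowski_nonneg hu' hv'
    rw [QuadraticMap.polar_neg_right] at this
    linarith
  · have := polar_minkowski_nonneg hu' hv'
    rw [QuadraticMap.polar_neg_left] at this
    linarith
  · have h1 := polar_minkowski_nonneg h hu'
    rw [QuadraticMap.polar_neg_right, QuadraticMap.polar_add_left, QuadraticMap.polar_self] at h1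
    rw [hu, QuadraticMap.polar_comm, smul_zero] at h1
    linarith

/-- Every point of the forward cone is a sum of two null vectors of the cone on which `√F` is
additive. A line in the direction of the isotropic vector `k` leaves the cone in null vectors, and
`F` is constant on it. For `minkowski k < 0` it leaves the cone at both ends; for
`minkowski k = 0` it does so at one end, and `k` itself is the second null vector. -/
theorem exists_null_add_null {F : QuadraticForm ℝ (Fin 4 → ℝ)} (hF : ∀ x, 0 ≤ F x)
    {k : Fin 4 → ℝ} (hk0 : k ≠ 0) (hFk : F k = 0) (hk : minkowski k ≤ 0) {x : Fin 4 → ℝ}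
    (hx : x ∈ forwardCone) :
    ∃ y ∈ forwardCone, ∃ z ∈ forwardCone, minkowski y = 0 ∧ minkowski z = 0 ∧ x = y + z ∧
      √(F x) = √(F y) + √(F z) := by
  rcases hx.2.2.eq_or_lt' with hx0 | hx0
  · exact ⟨x, hx, 0, ⟨le_rfl, le_rfl, by simp⟩, hx0, by simp, by simp, by simp⟩
  -- Membership in the cone comes for free by `mem_forwardCone_of_add`.
  suffices h : ∃ y z, minkowski y = 0 ∧ minkowski z = 0 ∧ x = y + z ∧
      √(F x) = √(F y) + √(F z) by
    obtain ⟨y, z, hy, hz, rfl, h⟩ := h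
    obtain ⟨hy', hz'⟩ := mem_forwardCone_of_add hy hz hx hx0
    exact ⟨y, hy', z, hz', hy, hz, rfl, h⟩
  rcases hk.eq_or_lt with hk | hk
  · have hp : QuadraticMap.polar minkowski x k ≠ 0 := by
      rcases mem_or_neg_mem_forwardCone hk.ge with h | h
      · exact (polar_minkowski_pos hx hx0 h hk0).ne'
      · have := polar_minkowski_pos hx hx0 h (neg_ne_zero.2 hk0)
        rw [QuadraticMap.polar_neg_right] at this
        exact (neg_pos.1 this).ne
    set t := minkowski x / QuadraticMap.polar minkowski x k with ht
    refine ⟨x + (-t) • k, t • k, ?_, ?_, by simp, ?_⟩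
    · rw [QuadraticForm.map_add_smul_real, hk, ht]
      field_simp
      ring
    · rw [QuadraticMap.map_smul, hk, smul_zero]
    · rw [QuadraticForm.map_add_smul_eq_of_map_eq_zero hF hFk, QuadraticMap.map_smul, hFk]
      simp
  · obtain ⟨s, t, hs, ht, hs0, ht0, -⟩ := QuadraticForm.exists_neg_pos_roots
      (α := -minkowski x) (β := -QuadraticMap.polar minkowski x k) (γ := -minkowski k)
      (neg_lt_zero.2 hx0) (neg_pos.2 hk)
    have hts : t - s ≠ 0 := by linarith
    refine ⟨(t / (t - s)) • (x + s • k), (-s / (t - s)) • (x + t • k), ?_, ?_, ?_, ?_⟩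
    · rw [QuadraticMap.map_smul, QuadraticForm.map_add_smul_real, smul_eq_mul]
      exact mul_eq_zero_of_right _ (by linarith)
    · rw [QuadraticMap.map_smul, QuadraticForm.map_add_smul_real, smul_eq_mul]
      exact mul_eq_zero_of_right _ (by linarith)
    · ext i
      simp only [Pi.add_apply, Pi.smul_apply, smul_eq_mul]
      field_simp
      ring
    · rw [QuadraticForm.sqrt_map_smul F (div_nonneg ht.le (by linarith)),
        QuadraticForm.sqrt_map_smul F (div_nonneg (by linarith) (by linarith)),
        QuadraticForm.map_add_smul_eq_of_map_eq_zero hF hFk,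
        QuadraticForm.map_add_smul_eq_of_map_eq_zero hF hFk]
      field_simp
      ring

theorem isHermitian_ketBra {d : Type*} (ψ : EuclideanSpace ℂ d) : (ketBra ψ).IsHermitian := by
  ext i j
  simp [ketBra, mul_comm]

theorem ketBra_eq_vecMulVec {d : Type*} (ψ : EuclideanSpace ℂ d) :
    ketBra ψ = Matrix.vecMulVec ψ.ofLp (star ψ.ofLp) := rfl

theorem minkowski_hermCoord_ketBra (v : EuclideanSpace ℂ (Fin 2)) :
    minkowski (hermCoord (ketBra v)) = 0 := by
  rw [minkowski, QuadraticMap.comp_apply, herm_hermCoord (isHermitian_ketBra v), reDet_apply]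
  have : (ketBra v).det = 0 := by
    simp [Matrix.det_fin_two, ketBra]
    ring
  rw [this, Complex.zero_re]

/-- The null vectors of the forward cone are the unnormalized pure states. -/
theorem exists_ketBra_eq_herm {x : Fin 4 → ℝ} (hx : x ∈ forwardCone) (hx' : minkowski x = 0) :
    ∃ v : EuclideanSpace ℂ (Fin 2), ketBra v = herm x := by
  obtain ⟨h0, h1, -⟩ := hx
  rw [minkowski_apply] at hx'
  rcases h0.eq_or_lt' with h | h
  · have h2 : x 2 = 0 := by rw [h] at hx'; nlinarith [sq_nonneg (x 2), sq_nonneg (x 3)]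
    have h3 : x 3 = 0 := by rw [h] at hx'; nlinarith [sq_nonneg (x 2), sq_nonneg (x 3)]
    refine ⟨!₂[0, (√(x 1) : ℂ)], ?_⟩
    ext i j
    fin_cases i <;> fin_cases j <;>
      simp [ketBra, herm_apply, h, h2, h3, Complex.ext_iff, Real.mul_self_sqrt h1]
  · have hr : √(x 0) * √(x 0) = x 0 := Real.mul_self_sqrt h0
    have hr0 : √(x 0) ≠ 0 := (Real.sqrt_pos.2 h).ne'
    refine ⟨!₂[(√(x 0) : ℂ), ⟨x 2 / √(x 0), -x 3 / √(x 0)⟩], ?_⟩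
    ext i j
    fin_cases i <;> fin_cases j <;>
      simp [ketBra, herm_apply, Complex.ext_iff, hr, hr0, mul_div_cancel₀]
    field_simp
    rw [sq (√(x 0)), hr]
    exact ⟨by linarith, by ring⟩

open Matrix

/-! ### Pure states, decompositions and compression to a subspace -/

section

variable {d : Type*} [Fintype d]

theorem posSemidef_ketBra (ψ : EuclideanSpace ℂ d) : (ketBra ψ).PosSemidef :=
  Matrix.posSemidef_vecMulVec_self_star ψ.ofLp

theorem trace_ketBra (ψ : EuclideanSpace ℂ d) : (ketBra ψ).trace = ((‖ψ‖ ^ 2 : ℝ) : ℂ) := by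
  rw [EuclideanSpace.norm_sq_eq, Matrix.trace]
  push_cast
  refine Finset.sum_congr rfl fun i _ ↦ ?_
  simp [ketBra, Complex.mul_conj, Complex.normSq_eq_norm_sq]

theorem ketBra_smul {d : Type*} (t : ℝ) (ψ : EuclideanSpace ℂ d) :
    ketBra ((t : ℂ) • ψ) = ((t ^ 2 : ℝ) : ℂ) • ketBra ψ := by
  ext i j
  simp [ketBra]
  ring

theorem mul_ketBra_mul_conjTranspose {d' : Type*} [DecidableEq d] (A : Matrix d' d ℂ)
    (ψ : EuclideanSpace ℂ d) :
    A * ketBra ψ * Aᴴ = ketBra (Matrix.toEuclideanLin A ψ) := by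
  rw [ketBra_eq_vecMulVec, ketBra_eq_vecMulVec, Matrix.mul_vecMulVec, Matrix.vecMulVec_mul,
    Matrix.ofLp_toLpLin, Matrix.toLin'_apply, Matrix.star_mulVec]

theorem rootDet_smul {t : ℝ} (ht : 0 ≤ t) (M : Matrix (Fin 2) (Fin 2) ℂ) :
    rootDet ((t : ℂ) • M) = t * rootDet M := by
  have h : ((t : ℂ) • M).det.re = reDet (t • M) := rfl
  rw [rootDet, h, QuadraticForm.sqrt_map_smul _ ht, rootDet, reDet_apply]
  ring

/-- A decomposition into unnormalized, possibly vanishing vectors gives an element of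
`decompositionValues`, by homogeneity of `rootDet`. -/
theorem sum_rootDet_mem_decompositionValues {Φ : Matrix d d ℂ →ₗ[ℂ] Matrix (Fin 2) (Fin 2) ℂ}
    {ρ : Matrix d d ℂ} (hρ : ρ.trace = 1) {ι : Type*} [Fintype ι] (φ : ι → EuclideanSpace ℂ d)
    (h : ρ = ∑ i, ketBra (φ i)) :
    ∑ i, rootDet (Φ (ketBra (φ i))) ∈ decompositionValues Φ ρ := by
  classical
  -- `decompositionValues` asks for positive weights, so the vanishing vectors are dropped.
  let s : Finset ι := {i | φ i ≠ 0}
  have hs : ∀ i ∈ s, ‖φ i‖ ≠ 0 := fun i hi ↦ norm_ne_zero_iff.2 (Finset.mem_filter.1 hi).2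
  let e := s.equivFin.symm
  have hsum : ∀ {M : Type} [AddCommMonoid M] (f : ι → M), (∀ i, φ i = 0 → f i = 0) →
      ∑ j, f (e j) = ∑ i, f i := fun f hf ↦ by
    rw [e.sum_comp (fun i : s ↦ f i), Finset.sum_coe_sort s f]
    exact Finset.sum_filter_of_ne fun i _ hi h0 ↦ hi (hf i h0)
  have hsum' : ∑ j, ketBra (φ (e j)) = ∑ i, ketBra (φ i) := by
    rw [e.sum_comp (fun i : s ↦ ketBra (φ i)), Finset.sum_coe_sort s (fun i ↦ ketBra (φ i))]
    refine Finset.sum_filter_of_ne fun i _ hi h0 ↦ hi ?_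
    ext a b
    simp [ketBra, h0]
  have hk : ∀ j, ((‖φ (e j)‖ ^ 2 : ℝ) : ℂ) • ketBra (((‖φ (e j)‖⁻¹ : ℝ) : ℂ) • φ (e j)) =
      ketBra (φ (e j)) := fun j ↦ by
    rw [ketBra_smul, smul_smul, ← Complex.ofReal_mul, ← mul_pow,
      mul_inv_cancel₀ (hs _ (e j).2), one_pow, Complex.ofReal_one, one_smul]
  refine ⟨_, fun j ↦ ‖φ (e j)‖ ^ 2, fun j ↦ ((‖φ (e j)‖⁻¹ : ℝ) : ℂ) • φ (e j), fun j ↦ ?_, ?_,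
    fun j ↦ ?_, ?_, ?_⟩
  · have := hs _ (e j).2
    positivity
  · rw [hsum (fun i ↦ ‖φ i‖ ^ 2) (fun i hi ↦ by simp [hi])]
    rw [h, Matrix.trace_sum] at hρ
    simp_rw [trace_ketBra] at hρ
    exact_mod_cast hρ
  · rw [norm_smul, Complex.norm_real, norm_inv, norm_norm, inv_mul_cancel₀ (hs _ (e j).2)]
  · simp_rw [hk]
    rw [hsum', h]
  · rw [← hsum (fun i ↦ rootDet (Φ (ketBra (φ i)))) (fun i hi ↦ ?_)]
    · refine Finset.sum_congr rfl fun j _ ↦ ?_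
      rw [← rootDet_smul (by positivity), ← map_smul, hk]
    · have : ketBra (φ i) = 0 := by
        ext a b
        simp [ketBra, hi]
      simp [this, rootDet]

/-- If `P * ρ = ρ`, then `P` fixes every vector that occurs in a convex decomposition of `ρ`, as
`(1 - P) * ρ * (1 - P)ᴴ = 0` is a sum of positive semidefinite terms. -/
theorem toEuclideanLin_eq_self_of_sum_eq [DecidableEq d] {P ρ : Matrix d d ℂ}
    (hPρ : P * ρ = ρ) {ι : Type*} [Fintype ι] {p : ι → ℝ} (hp : ∀ i, 0 < p i)
    {ψ : ι → EuclideanSpace ℂ d} (h : ρ = ∑ i, (p i : ℂ) • ketBra (ψ i)) (i : ι) :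
    Matrix.toEuclideanLin P (ψ i) = ψ i := by
  have h1 : (1 - P) * ρ * (1 - P)ᴴ = 0 := by
    rw [Matrix.sub_mul, one_mul, hPρ, sub_self, Matrix.zero_mul]
  rw [h, Finset.mul_sum, Finset.sum_mul] at h1
  simp_rw [Matrix.mul_smul, Matrix.smul_mul, mul_ketBra_mul_conjTranspose] at h1
  have h2 := congrArg Matrix.trace h1
  simp_rw [Matrix.trace_sum, Matrix.trace_smul, trace_ketBra, smul_eq_mul, ← Complex.ofReal_mul,
    ← Complex.ofReal_sum, Matrix.trace_zero] at h2
  rw [Complex.ofReal_eq_zero, Finset.sum_eq_zero_iff_of_nonneg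
    (fun i _ ↦ mul_nonneg (hp i).le (sq_nonneg _))] at h2
  have h3 := (mul_eq_zero.1 (h2 i (Finset.mem_univ i))).resolve_left (hp i).ne'
  have h4 := norm_eq_zero.1 (pow_eq_zero_iff two_ne_zero |>.1 h3)
  rw [map_sub, LinearMap.sub_apply, sub_eq_zero, Matrix.toLpLin_one] at h4
  exact h4.symm

variable {K : Submodule ℂ (EuclideanSpace ℂ d)}

/-- The matrix whose columns are the vectors of an orthonormal basis of the subspace `K`. -/
noncomputable def basisMatrix (e : OrthonormalBasis (Fin 2) ℂ K) : Matrix d (Fin 2) ℂ :=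
  Matrix.of fun i j ↦ (e j : EuclideanSpace ℂ d) i

variable (e : OrthonormalBasis (Fin 2) ℂ K)

theorem conjTranspose_basisMatrix_mul_self : (basisMatrix e)ᴴ * basisMatrix e = 1 := by
  ext i j
  have h : inner ℂ (e i) (e j) = if i = j then (1 : ℂ) else 0 :=
    orthonormal_iff_ite.1 e.orthonormal i j
  rw [Submodule.coe_inner, PiLp.inner_apply] at h
  rw [Matrix.one_apply, ← h, Matrix.mul_apply]
  refine Finset.sum_congr rfl fun k _ ↦ ?_
  simp [basisMatrix, mul_comm]

theorem toEuclideanLin_basisMatrix (v : EuclideanSpace ℂ (Fin 2)) :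
    Matrix.toEuclideanLin (basisMatrix e) v = ((∑ j, v j • e j : K) : EuclideanSpace ℂ d) := by
  ext i
  simp [basisMatrix, Matrix.toLpLin_apply, Matrix.mulVec, dotProduct, mul_comm]

variable [DecidableEq d]

theorem supportedBy_basisMatrix_mul (A : Matrix (Fin 2) d ℂ) :
    SupportedBy (basisMatrix e * A) K := by
  rintro _ ⟨x, rfl⟩
  rw [Matrix.toLpLin_mul 2 2 2, LinearMap.comp_apply, toEuclideanLin_basisMatrix]
  exact Subtype.property _

theorem basisMatrix_mul_conjTranspose_mul {ρ : Matrix d d ℂ} (h : SupportedBy ρ K) :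
    basisMatrix e * (basisMatrix e)ᴴ * ρ = ρ := by
  have hK : ∀ x ∈ K, Matrix.toEuclideanLin (basisMatrix e * (basisMatrix e)ᴴ) x = x := fun x hx ↦ by
    have hx' : x = Matrix.toEuclideanLin (basisMatrix e) (e.repr ⟨x, hx⟩) := by
      rw [toEuclideanLin_basisMatrix, e.sum_repr]
    rw [hx', ← LinearMap.comp_apply, ← Matrix.toLpLin_mul 2 2 2, Matrix.mul_assoc,
      conjTranspose_basisMatrix_mul_self, Matrix.mul_one]
  apply Matrix.toEuclideanLin.injective
  ext1 x
  rw [Matrix.toLpLin_mul 2 2 2, LinearMap.comp_apply, hK _ (h ⟨x, rfl⟩)]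

theorem detOn_eq_det (ρ : Matrix d d ℂ) :
    detOn K ρ = ((basisMatrix e)ᴴ * ρ * basisMatrix e).det := by
  rw [detOn, ← LinearMap.det_toMatrix e.toBasis]
  congr 1
  ext i j
  rw [LinearMap.toMatrix_apply, OrthonormalBasis.coe_toBasis_repr_apply,
    OrthonormalBasis.repr_apply_apply, OrthonormalBasis.coe_toBasis]
  have : inner ℂ (e i) (operatorOn K ρ (e j)) =
      inner ℂ (e i : EuclideanSpace ℂ d) (Matrix.toEuclideanLin ρ (e j)) := by
    simp [operatorOn]
  rw [this, PiLp.inner_apply, Matrix.mul_assoc, Matrix.mul_apply]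
  refine Finset.sum_congr rfl fun k _ ↦ ?_
  simp [basisMatrix, Matrix.mul_apply, Matrix.mulVec, dotProduct, mul_comm]

end

/-! ### The concurrence on a two-dimensional subspace -/

section

/-- The real quadratic form `x ↦ det Φ(U x Uᴴ)` in the coordinates of a Hermitian `2 × 2` matrix. -/
noncomputable def pulledBackDet {d : Type*} (Φ : Matrix d d ℂ →ₗ[ℂ] Matrix (Fin 2) (Fin 2) ℂ)
    (U : Matrix d (Fin 2) ℂ) : QuadraticForm ℝ (Fin 4 → ℝ) :=
  reDet.comp <| Φ.restrictScalars ℝ ∘ₗ mulRightLinearMap d ℝ Uᴴ ∘ₗ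
    mulLeftLinearMap (Fin 2) ℝ U ∘ₗ herm

theorem pulledBackDet_apply {d : Type*} (Φ : Matrix d d ℂ →ₗ[ℂ] Matrix (Fin 2) (Fin 2) ℂ)
    (U : Matrix d (Fin 2) ℂ) (x : Fin 4 → ℝ) :
    pulledBackDet Φ U x = (Φ (U * herm x * Uᴴ)).det.re := rfl

variable {d : Type*} [Fintype d]

theorem pulledBackDet_nonneg {Φ : Matrix d d ℂ →ₗ[ℂ] Matrix (Fin 2) (Fin 2) ℂ}
    (hΦ : ∀ M, M.PosSemidef → (Φ M).PosSemidef) (U : Matrix d (Fin 2) ℂ) {x : Fin 4 → ℝ}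
    (hx : minkowski x = 0) : 0 ≤ pulledBackDet Φ U x := by
  wlog h : x ∈ forwardCone generalizing x
  · have := this (x := -x) (by rwa [QuadraticMap.map_neg])
      ((mem_or_neg_mem_forwardCone hx.ge).resolve_left h)
    rwa [QuadraticMap.map_neg] at this
  obtain ⟨v, hv⟩ := exists_ketBra_eq_herm h hx
  rw [pulledBackDet_apply, ← hv]
  exact (Complex.nonneg_iff.1
    (hΦ _ ((posSemidef_ketBra v).mul_mul_conjTranspose_same U)).det_nonneg).1

theorem continuous_minkowski : Continuous minkowski := by
  have : (minkowski : (Fin 4 → ℝ) → ℝ) = fun x ↦ x 0 * x 1 - (x 2 ^ 2 + x 3 ^ 2) :=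
    funext minkowski_apply
  rw [this]
  fun_prop

theorem continuous_pulledBackDet {d : Type*} (Φ : Matrix d d ℂ →ₗ[ℂ] Matrix (Fin 2) (Fin 2) ℂ)
    (U : Matrix d (Fin 2) ℂ) : Continuous (pulledBackDet Φ U) := by
  set L : (Fin 4 → ℝ) →ₗ[ℝ] Matrix (Fin 2) (Fin 2) ℂ := Φ.restrictScalars ℝ ∘ₗ
    mulRightLinearMap d ℝ Uᴴ ∘ₗ mulLeftLinearMap (Fin 2) ℝ U ∘ₗ herm
  have hL : Continuous L := L.continuous_of_finiteDimensional
  exact Complex.continuous_re.comp hL.matrix_det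

theorem hermCoord_mem_forwardCone {r : Matrix (Fin 2) (Fin 2) ℂ} (hr : r.PosSemidef) :
    hermCoord r ∈ forwardCone := by
  refine ⟨(Complex.nonneg_iff.1 (hr.diag_nonneg (i := 0))).1,
    (Complex.nonneg_iff.1 (hr.diag_nonneg (i := 1))).1, ?_⟩
  have := hr.det_nonneg
  rw [← herm_hermCoord hr.isHermitian, det_herm] at this
  exact_mod_cast this

theorem mul_compression_mul_conjTranspose {U : Matrix d (Fin 2) ℂ} {ρ : Matrix d d ℂ}
    (hρ : ρ.IsHermitian) (h : U * Uᴴ * ρ = ρ) : U * (Uᴴ * ρ * U) * Uᴴ = ρ := by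
  have h' := congrArg conjTranspose h
  rw [conjTranspose_mul, conjTranspose_mul, conjTranspose_conjTranspose, hρ.eq] at h'
  calc U * (Uᴴ * ρ * U) * Uᴴ = U * Uᴴ * ρ * (U * Uᴴ) := by simp only [Matrix.mul_assoc]
    _ = ρ := by rw [h, h']

variable [DecidableEq d]

/-- The convex roof on the states `ρ` with `U * Uᴴ * ρ = ρ`, that is, those supported by the range
of `U` when `U` is an isometry, with `F` the degenerate form `det Φ(U x Uᴴ) - w det x`. Any
decomposition has value at least `2 √F`, because `√F` is subadditive and agrees with `√(det Φ)` on
pure states; the decomposition of `exists_null_add_null` attains this bound. -/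
theorem isLeast_decompositionValues {Φ : Matrix d d ℂ →ₗ[ℂ] Matrix (Fin 2) (Fin 2) ℂ}
    {U : Matrix d (Fin 2) ℂ} {w : ℝ}
    (hF : ∀ x, 0 ≤ (pulledBackDet Φ U - w • minkowski) x) {k : Fin 4 → ℝ} (hk0 : k ≠ 0)
    (hFk : (pulledBackDet Φ U - w • minkowski) k = 0) (hk : minkowski k ≤ 0)
    {ρ : Matrix d d ℂ} (hρ : IsDensity ρ) (hUρ : U * Uᴴ * ρ = ρ) :
    IsLeast (decompositionValues Φ ρ)
      (2 * √((pulledBackDet Φ U - w • minkowski) (hermCoord (Uᴴ * ρ * U)))) := by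
  set F := pulledBackDet Φ U - w • minkowski with hFdef
  have hFnull : ∀ {x}, minkowski x = 0 → 2 * √(F x) = rootDet (Φ (U * herm x * Uᴴ)) :=
    fun {x} hx ↦ by
      rw [rootDet, hFdef, _root_.sub_apply, _root_.smul_apply, hx, smul_zero, sub_zero,
        pulledBackDet_apply]
  constructor
  · have hr : (Uᴴ * ρ * U).PosSemidef := hρ.1.conjTranspose_mul_mul_same U
    obtain ⟨y, hy, z, hz, hy0, hz0, hyz, hsqrt⟩ :=
      exists_null_add_null hF hk0 hFk hk (hermCoord_mem_forwardCone hr)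
    obtain ⟨u, hu⟩ := exists_ketBra_eq_herm hy hy0
    obtain ⟨v, hv⟩ := exists_ketBra_eq_herm hz hz0
    have hρ' : ρ = ∑ i, ketBra (![toEuclideanLin U u, toEuclideanLin U v] i) := by
      rw [Fin.sum_univ_two]
      simp only [cons_val_zero, cons_val_one]
      rw [← mul_ketBra_mul_conjTranspose, ← mul_ketBra_mul_conjTranspose, ← Matrix.add_mul,
        ← Matrix.mul_add, hu, hv, ← map_add, ← hyz, herm_hermCoord hr.isHermitian,
        mul_compression_mul_conjTranspose hρ.1.isHermitian hUρ]
    have := sum_rootDet_mem_decompositionValues (Φ := Φ) hρ.2 _ hρ'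
    rw [Fin.sum_univ_two] at this
    simp only [cons_val_zero, cons_val_one] at this
    rwa [← mul_ketBra_mul_conjTranspose, ← mul_ketBra_mul_conjTranspose, hu, hv, ← hFnull hy0,
      ← hFnull hz0, ← mul_add, ← hsqrt] at this
  · rintro _ ⟨m, p, ψ, hp, -, -, h, rfl⟩
    have hfix := toEuclideanLin_eq_self_of_sum_eq hUρ hp h
    set y : Fin m → Fin 4 → ℝ :=
      fun j ↦ hermCoord (ketBra (toEuclideanLin Uᴴ (ψ j))) with hy
    have hy0 : ∀ j, minkowski (y j) = 0 := fun j ↦ minkowski_hermCoord_ketBra _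
    have hyψ : ∀ j, U * herm (y j) * Uᴴ = ketBra (ψ j) := fun j ↦ by
      rw [hy, herm_hermCoord (isHermitian_ketBra _), mul_ketBra_mul_conjTranspose,
        ← LinearMap.comp_apply, ← toLpLin_mul 2 2 2, hfix]
    have hsum : hermCoord (Uᴴ * ρ * U) = ∑ j, p j • y j := by
      rw [h, Matrix.mul_sum, Matrix.sum_mul, map_sum]
      refine Finset.sum_congr rfl fun j _ ↦ ?_
      rw [hy, ← map_smul, ← mul_ketBra_mul_conjTranspose, conjTranspose_conjTranspose,
        Matrix.mul_smul, Matrix.smul_mul]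
      rfl
    rw [hsum]
    calc 2 * √(F (∑ j, p j • y j)) ≤ 2 * ∑ j, √(F (p j • y j)) :=
          mul_le_mul_of_nonneg_left (QuadraticForm.sqrt_map_sum_le hF _ _) zero_le_two
      _ = ∑ j, p j * rootDet (Φ (ketBra (ψ j))) := by
          rw [Finset.mul_sum]
          refine Finset.sum_congr rfl fun j _ ↦ ?_
          rw [QuadraticForm.sqrt_map_smul _ (hp j).le, ← hyψ, ← hFnull (hy0 j)]
          ring

/-- For a positive map `Φ` into the `2 × 2` matrices, the `Φ`-concurrence is attained on the states
supported by a two-dimensional subspace, and its square is `4 (det Φ(ρ) - w det ρ)` there. -/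
theorem exists_phiConcurrence_sq_eq {Φ : Matrix d d ℂ →ₗ[ℂ] Matrix (Fin 2) (Fin 2) ℂ}
    (hΦ : ∀ M, M.PosSemidef → (Φ M).PosSemidef) {K : Submodule ℂ (EuclideanSpace ℂ d)}
    (e : OrthonormalBasis (Fin 2) ℂ K) :
    ∃ w : ℝ, ∀ ρ, IsDensity ρ → SupportedBy ρ K →
      IsLeast (decompositionValues Φ ρ) (phiConcurrence Φ ρ) ∧
      (phiConcurrence Φ ρ : ℂ) ^ 2 = 4 * ((Φ ρ).det - (w : ℂ) * detOn K ρ) := by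
  obtain ⟨w, hF, k, hk0, hFk, hk⟩ := QuadraticForm.exists_nonneg_sub_smul_and_isotropic
    (continuous_pulledBackDet Φ (basisMatrix e)) continuous_minkowski
    (fun x hx ↦ pulledBackDet_nonneg hΦ _ hx)
    ⟨![0, 0, 1, 0], by simp [minkowski_apply]⟩ ⟨![1, 1, 0, 0], by simp [minkowski_apply]⟩
  refine ⟨w, fun ρ hρ hK ↦ ?_⟩
  have hUρ := basisMatrix_mul_conjTranspose_mul e hK
  have h := isLeast_decompositionValues hF hk0 hFk hk hρ hUρ
  have hC : phiConcurrence Φ ρ = _ := h.csInf_eq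
  rw [hC]
  refine ⟨h, ?_⟩
  have hr : ((basisMatrix e)ᴴ * ρ * basisMatrix e).PosSemidef :=
    hρ.1.conjTranspose_mul_mul_same _
  have hdet : (((Φ ρ).det.re : ℝ) : ℂ) = (Φ ρ).det :=
    Complex.ext rfl (Complex.nonneg_iff.1 (hΦ ρ hρ.1).det_nonneg).2
  rw [← Complex.ofReal_pow, mul_pow, Real.sq_sqrt (hF _), _root_.sub_apply,
    _root_.smul_apply, pulledBackDet_apply, herm_hermCoord hr.isHermitian,
    mul_compression_mul_conjTranspose hρ.1.isHermitian hUρ, detOn_eq_det e,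
    ← herm_hermCoord hr.isHermitian, det_herm]
  push_cast
  rw [hdet, herm_hermCoord hr.isHermitian]
  norm_num

/-- The normalized projection onto `K` is a state with nonzero determinant. -/
theorem exists_isDensity_detOn_ne_zero {K : Submodule ℂ (EuclideanSpace ℂ d)}
    (e : OrthonormalBasis (Fin 2) ℂ K) :
    ∃ ρ, IsDensity ρ ∧ SupportedBy ρ K ∧ detOn K ρ ≠ 0 := by
  have hU := conjTranspose_basisMatrix_mul_self e
  refine ⟨basisMatrix e * ((1 / 2 : ℂ) • (basisMatrix e)ᴴ), ⟨?_, ?_⟩,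
    supportedBy_basisMatrix_mul e _, ?_⟩
  · rw [Matrix.mul_smul]
    exact (posSemidef_self_mul_conjTranspose _).smul (by norm_num [Complex.nonneg_iff])
  · rw [trace_mul_comm, Matrix.smul_mul, hU, trace_smul, trace_one]
    norm_num
  · rw [detOn_eq_det e, Matrix.mul_smul, Matrix.mul_smul, Matrix.smul_mul, ← Matrix.mul_assoc, hU,
      Matrix.one_mul, hU, det_smul, det_one]
    norm_num

end

theorem posSemidef_partialTraceB {a b : Type*} [Fintype a] [Fintype b]
    {M : Matrix (a × b) (a × b) ℂ} (hM : M.PosSemidef) : (partialTraceB a b M).PosSemidef := by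
  have : partialTraceB a b M = ∑ k, M.submatrix (fun i ↦ (i, k)) (fun i ↦ (i, k)) := by
    ext i j
    simp [partialTraceB, Matrix.sum_apply]
  rw [this]
  exact posSemidef_sum _ fun k _ ↦ hM.submatrix _

end QubitConcurrence

theorem mainTheorem7 (n : ℕ) (H₂ : Submodule ℂ (EuclideanSpace ℂ (Fin 2 × Fin n)))
    (hdim : Module.finrank ℂ H₂ = 2) :
    (∀ ρ : Matrix (Fin 2 × Fin n) (Fin 2 × Fin n) ℂ,
      QubitConcurrence.IsDensity ρ → QubitConcurrence.SupportedBy ρ H₂ →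
        IsLeast (QubitConcurrence.decompositionValues
            (QubitConcurrence.partialTraceB (Fin 2) (Fin n)) ρ)
          (QubitConcurrence.concurrence ρ)) ∧
    ∃! w : ℝ, ∀ ρ : Matrix (Fin 2 × Fin n) (Fin 2 × Fin n) ℂ,
      QubitConcurrence.IsDensity ρ → QubitConcurrence.SupportedBy ρ H₂ →
        ((QubitConcurrence.concurrence ρ : ℝ) : ℂ) ^ 2 =
          4 * ((QubitConcurrence.partialTraceB (Fin 2) (Fin n) ρ).det -
            (w : ℂ) * QubitConcurrence.detOn H₂ ρ) := by
  have e : OrthonormalBasis (Fin 2) ℂ H₂ :=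
    (stdOrthonormalBasis ℂ H₂).reindex (finCongr hdim)
  obtain ⟨w, hw⟩ := QubitConcurrence.exists_phiConcurrence_sq_eq
    (Φ := QubitConcurrence.partialTraceB (Fin 2) (Fin n))
    (fun _ ↦ QubitConcurrence.posSemidef_partialTraceB) e
  refine ⟨fun ρ hρ hK ↦ (hw ρ hρ hK).1, w, fun ρ hρ hK ↦ (hw ρ hρ hK).2, fun w' hw' ↦ ?_⟩
  obtain ⟨ρ, hρ, hK, hdet⟩ := QubitConcurrence.exists_isDensity_detOn_ne_zero e
  have h := (hw' ρ hρ hK).symm.trans (hw ρ hρ hK).2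
  have h1 : (w' : ℂ) * QubitConcurrence.detOn H₂ ρ = w * QubitConcurrence.detOn H₂ ρ := by
    linear_combination (-1 / 4) * h
  exact_mod_cast mul_right_cancel₀ hdet h1
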